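/- Let $\Sigma$ be a semigroup, $W$ a finite-dimensional real vector space and $A:\Sigma\to\mathfrak{gl}(W)$ a representation, i.e. $A_\sigma\circ A_\tau=A_{\sigma\tau}$ for all $\sigma,\tau\in\Sigma$. Subrepresentations are the subspaces stable under all $A_\sigma$, and homomorphisms of representations are the linear maps that commute with the actions. A nonzero representation is called indecomposable if it is not the direct sum of two nonzero subrepresentations. An indecomposable representation $U$ is called absolutely indecomposable (of real type) if $\mathrm{End}(U)/\mathrm{End}^{\mathrm{Nil}}(U)\cong\mathbb R$, where $\mathrm{End}(U)$ is the algebra of homomorphisms $U\to U$ and $\mathrm{End}^{\mathrm{Nil}}(U)$ is its ideal of nilpotent elements. The generalized kernel of a linear map $L:W\to W$ is $\bigcup_{n}\ker L^n$. Assume that $W$ is a direct sum of finitely many mutually non-isomorphic indecomposable subrepresentations. Let $X_0\in W$ be $\Sigma$-symmetric, i.e. $A_\sigma X_0=X_0$ for all $\sigma\in\Sigma$, let $\lambda_0<\lambda_1$ be real numbers, and let $E$ be the set of all smooth maps $\Gamma:W\times(\lambda_0,\lambda_1)\to W$ such that $\Gamma(A_\sigma X;\lambda)=A_\sigma\Gamma(X;\lambda)$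 and $\Gamma(X_0;\lambda)=0$ for all $\sigma\in\Sigma$, $X\in W$ and $\lambda\in(\lambda_0,\lambda_1)$. Let $E_{\mathrm{gp}}$ be the set of those $\Gamma\in E$ that are in general position, i.e. such that for every $\lambda\in(\lambda_0,\lambda_1)$ the generalized kernel of $D_X\Gamma(X_0;\lambda)$ is either trivial or an absolutely indecomposable subrepresentation of $W$. Then $E_{\mathrm{gp}}$ is open and dense in $E$ in the $C^1$-topology, i.e. in the topology (uniform on compact sets in $W$ and of Whitney type in $\lambda$) in which a neighbourhood basis of $\Gamma$ is formed by the sets $$\{\Gamma'\in E : \|\Gamma'(X;\lambda)-\Gamma(X;\lambda)\|<\varepsilon(\lambda)\ \text{ and }\ \|D\Gamma'(X;\lambda)-D\Gamma(X;\lambda)\|<\varepsilon(\lambda)\ \text{ for all } X\in K,\ \lambda\in(\lambda_0,\lambda_1)\},$$ where $K\subset W$ is compact, $\varepsilon:(\lambda_0,\lambda_1)\to(0,\infty)$ is continuous, and $D$ is the total derivative in $(X,\lambda)$. -/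

import Mathlib

open scoped ContDiff

/-! ### Representations of semigroups

A representation of a semigroup `S` in a real vector space `W` is a multiplicative map
`A : S →ₙ* Module.End ℝ W`, that is `A (s * t) = A s ∘ A t`; nothing is required about units. -/

namespace SemigroupRep

section Algebra

variable {S : Type*} [Semigroup S] {W W' : Type*} [AddCommGroup W] [Module ℝ W]
  [AddCommGroup W'] [Module ℝ W']

/-- `U` is a subrepresentation: `A s` maps `U` into `U` for every `s`. -/
def IsSubrep (A : S →ₙ* Module.End ℝ W) (U : Submodule ℝ W) : Prop :=
  ∀ s : S, ∀ x ∈ U, A s x ∈ U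

/-- The representation that `A` induces on a subrepresentation `U`. -/
def restrict (A : S →ₙ* Module.End ℝ W) (U : Submodule ℝ W) (hU : IsSubrep A U) :
    S →ₙ* Module.End ℝ U where
  toFun s := (A s).restrict (hU s)
  map_mul' s t := by
    ext x
    simp [LinearMap.restrict_apply]

/-- Isomorphism of representations: an invertible linear map that commutes with the actions. -/
def Isomorphic (A : S →ₙ* Module.End ℝ W) (A' : S →ₙ* Module.End ℝ W') : Prop :=
  ∃ e : W ≃ₗ[ℝ] W', ∀ (s : S) (x : W), e (A s x) = A' s (e x)

/-- A nonzero representation that is not the direct sum of two nonzero subrepresentations. -/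
def IsIndecomposable (A : S →ₙ* Module.End ℝ W) : Prop :=
  Nontrivial W ∧ ∀ U V : Submodule ℝ W, IsSubrep A U → IsSubrep A V → IsCompl U V →
    U = ⊥ ∨ V = ⊥

/-- The algebra `End(W)` of endomorphisms of a representation: all linear maps `L` with
`L ∘ A s = A s ∘ L` for every `s`. -/
def endAlgebra (A : S →ₙ* Module.End ℝ W) : Subalgebra ℝ (Module.End ℝ W) :=
  Subalgebra.centralizer ℝ (Set.range A)

/-- An indecomposable representation is absolutely indecomposable (of real type) if the nilpotent
endomorphisms form a two-sided ideal `I` of `End(W)` and `End(W) / I` is isomorphic to `ℝ`. -/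
def IsAbsolutelyIndecomposable (A : S →ₙ* Module.End ℝ W) : Prop :=
  IsIndecomposable A ∧
    ∃ I : TwoSidedIdeal (endAlgebra A), (∀ L : endAlgebra A, L ∈ I ↔ IsNilpotent L) ∧
      Nonempty (I.ringCon.Quotient ≃ₐ[ℝ] ℝ)

/-- `W` is the (internal) direct sum of finitely many subrepresentations that are indecomposable
and mutually non-isomorphic. -/
def SplitsIntoNonIsomorphicIndecomposables (A : S →ₙ* Module.End ℝ W) : Prop :=
  ∃ (m : ℕ) (U : Fin m → Submodule ℝ W) (hU : ∀ i, IsSubrep A (U i)),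
    DirectSum.IsInternal U ∧
    (∀ i, IsIndecomposable (restrict A (U i) (hU i))) ∧
    ∀ i j, i ≠ j → ¬ Isomorphic (restrict A (U i) (hU i)) (restrict A (U j) (hU j))

/-- The generalized kernel `⋃ₙ ker Lⁿ`, that is the kernel of the semisimple part of `L`. -/
def generalizedKernel (L : Module.End ℝ W) : Submodule ℝ W :=
  L.maxGenEigenspace 0

end Algebra

/-! ### One-parameter families of equivariant vector fields -/

section Families

variable {S : Type*} [Semigroup S] {W : Type*} [NormedAddCommGroup W] [NormedSpace ℝ W]

/-- The space `E` of smooth maps `Γ : W × (a, b) → W` such that every `Γ(·; t)` commutes with the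
action of `S` and vanishes at `X₀`. A map on `W × (a, b)` is recorded by its extension by zero to
`W × ℝ`, so that two families are equal exactly when they agree on `W × (a, b)`. -/
@[ext]
structure EquivariantFamily (A : S →ₙ* Module.End ℝ W) (X₀ : W) (a b : ℝ) where
  toFun : W × ℝ → W
  smooth : ContDiffOn ℝ ∞ toFun (Set.univ ×ˢ Set.Ioo a b)
  equivariant : ∀ (s : S) (X : W), ∀ t ∈ Set.Ioo a b, toFun (A s X, t) = A s (toFun (X, t))
  equilibrium : ∀ t ∈ Set.Ioo a b, toFun (X₀, t) = 0
  zero_outside : ∀ (X : W) (t : ℝ), t ∉ Set.Ioo a b → toFun (X, t) = 0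

namespace EquivariantFamily

variable {A : S →ₙ* Module.End ℝ W} {X₀ : W} {a b : ℝ}

/-- The linearization `D_X Γ(X₀; t)`. -/
noncomputable def linearization (Γ : EquivariantFamily A X₀ a b) (t : ℝ) : Module.End ℝ W :=
  (fderiv ℝ (fun X : W => Γ.toFun (X, t)) X₀ : W →L[ℝ] W)

/-- The basic `C¹`-neighbourhood of `Γ` given by a set `K` in phase space and a gauge `ε` on the
parameter interval: the families whose values and total first derivatives (in `X` and in the
parameter) differ from those of `Γ` by less than `ε t` at each `(X, t)` in `K × (a, b)`. -/
def basicNhd (Γ : EquivariantFamily A X₀ a b) (K : Set W) (ε : ℝ → ℝ) :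
    Set (EquivariantFamily A X₀ a b) :=
  {Γ' | ∀ X ∈ K, ∀ t ∈ Set.Ioo a b,
    ‖Γ'.toFun (X, t) - Γ.toFun (X, t)‖ < ε t ∧
    ‖fderiv ℝ Γ'.toFun (X, t) - fderiv ℝ Γ.toFun (X, t)‖ < ε t}

/-- The `C¹`-topology on `E`: uniform on compact sets in phase space and of Whitney (strong) type
on the open parameter interval. A set is open if with each `Γ` it contains a basic neighbourhood of
`Γ` given by a compact `K ⊆ W` and a positive continuous function `ε` on `(a, b)`. -/
instance c1Topology : TopologicalSpace (EquivariantFamily A X₀ a b) where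
  IsOpen 𝒰 := ∀ Γ ∈ 𝒰, ∃ (K : Set W) (ε : ℝ → ℝ), IsCompact K ∧
    ContinuousOn ε (Set.Ioo a b) ∧ (∀ t ∈ Set.Ioo a b, 0 < ε t) ∧ basicNhd Γ K ε ⊆ 𝒰
  isOpen_univ := fun _ _ => ⟨∅, fun _ => 1, isCompact_empty, continuousOn_const,
    fun _ _ => one_pos, Set.subset_univ _⟩
  isOpen_inter := by
    rintro 𝒰 𝒱 h𝒰 h𝒱 Γ ⟨hΓ, hΓ'⟩
    obtain ⟨K, ε, hK, hε, hpos, hsub⟩ := h𝒰 Γ hΓ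
    obtain ⟨K', ε', hK', hε', hpos', hsub'⟩ := h𝒱 Γ hΓ'
    refine ⟨K ∪ K', fun t => min (ε t) (ε' t), hK.union hK', hε.inf hε',
      fun t ht => lt_min (hpos t ht) (hpos' t ht), fun Γ₁ h₁ => ⟨hsub ?_, hsub' ?_⟩⟩
    · intro X hX t ht
      obtain ⟨h0, h1⟩ := h₁ X (Or.inl hX) t ht
      exact ⟨h0.trans_le (min_le_left _ _), h1.trans_le (min_le_left _ _)⟩
    · intro X hX t ht
      obtain ⟨h0, h1⟩ := h₁ X (Or.inr hX) t ht
      exact ⟨h0.trans_le (min_le_right _ _), h1.trans_le (min_le_right _ _)⟩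
  isOpen_sUnion := by
    rintro C hC Γ ⟨𝒰, h𝒰, hΓ⟩
    obtain ⟨K, ε, hK, hε, hpos, hsub⟩ := hC 𝒰 h𝒰 Γ hΓ
    exact ⟨K, ε, hK, hε, hpos, hsub.trans (Set.subset_sUnion_of_mem h𝒰)⟩

/-- The families in general position: at every parameter value the generalized kernel of the
linearization at `X₀` is trivial or an absolutely indecomposable subrepresentation. -/
def generalPosition (A : S →ₙ* Module.End ℝ W) (X₀ : W) (a b : ℝ) :
    Set (EquivariantFamily A X₀ a b) :=
  {Γ | ∀ t ∈ Set.Ioo a b,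
    generalizedKernel (Γ.linearization t) = ⊥ ∨
    ∃ h : IsSubrep A (generalizedKernel (Γ.linearization t)),
      IsAbsolutelyIndecomposable (restrict A (generalizedKernel (Γ.linearization t)) h)}

end EquivariantFamily

end Families

end SemigroupRep

/-!
The linearization at `X₀` of an equivariant family is a curve `L(t)` in the algebra `C` of
endomorphisms of the representation `W`. Everything rests on a description of the degenerate
endomorphisms: they form a finite union of linear subspaces of `C` of codimension at least two.

Write `W = ⨁ U i` with indecomposable, mutually non-isomorphic `U i`. By Fitting's lemma every
endomorphism of `U i` is nilpotent or invertible, so the nilpotent ones form an ideal, and an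
endomorphism of `U i` that factors through another `U j` is nilpotent. Hence the maps in `C` whose
`i`-th diagonal block is nilpotent form a prime ideal `nilBlock i` of `C`
(`mul_mem_nilBlock_iff`). Let `p` be the projection onto the generalized kernel `V` of `L ∈ C` along
its Fitting complement. Modulo `nilBlock i` it is `1` if `L ∈ nilBlock i` and `0` otherwise. Taking
traces gives `dim V = ∑ dim U i`, the sum over all `i` with `L ∈ nilBlock i`
(`finrank_generalizedKernel`), and each such `U i` is a direct summand of `V`. So `V` is trivial or
absolutely indecomposable if and only if `L` lies in at most one `nilBlock i`, and then only in one
for which `U i` is absolutely indecomposable (`generalizedKernel_eq_bot_or_iff`). What is excluded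
are the subspaces `nilBlock i ⊓ nilBlock j` for `i ≠ j`, and `nilBlock i` if `U i` is not absolutely
indecomposable. These have codimension at least two (`finrank_degenerate_add_two_le`), in the last
case because `C / nilBlock i` contains more than the scalars.

Openness follows as these subspaces are closed: the distance of `L(t)` to their union is a positive
continuous function of `t`. For density, let `ρ` be a smooth function, positive on `(a, b)`, that is
small together with its derivative in comparison with the given gauge
(`exists_contDiff_pos_le_gauge`), and perturb `Γ` to `Γ(X; t) + ρ(t) e (X - X₀)` with `e ∈ C`. The
linearization becomes `ρ(t) (L(t) / ρ(t) + e)`. Since the degenerate maps are closed under scaling,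
`e` only has to translate the curve `L / ρ` off the subspaces. The `e` for which this fails form a
finite union of smooth images of spaces of dimension less than `dim C`, so the others are dense
(`dense_forall_add_notMem`).
-/

/-! ### Endomorphisms of indecomposable representations -/

namespace SemigroupRep

section Hom

variable {S : Type*} [Semigroup S] {V V' V'' : Type*} [AddCommGroup V] [Module ℝ V]
  [AddCommGroup V'] [Module ℝ V'] [AddCommGroup V''] [Module ℝ V'']
  {A : S →ₙ* Module.End ℝ V} {A' : S →ₙ* Module.End ℝ V'} {A'' : S →ₙ* Module.End ℝ V''}

/-- Homomorphisms of representations: linear maps that commute with the actions. -/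
def IsHom (A : S →ₙ* Module.End ℝ V) (A' : S →ₙ* Module.End ℝ V') (f : V →ₗ[ℝ] V') : Prop :=
  ∀ (s : S) (x : V), f (A s x) = A' s (f x)

theorem mem_endAlgebra_iff {L : Module.End ℝ V} : L ∈ endAlgebra A ↔ IsHom A A L := by
  simp only [endAlgebra, Subalgebra.mem_centralizer_iff, Set.forall_mem_range, IsHom,
    LinearMap.ext_iff, Module.End.mul_apply]
  exact forall_congr' fun s => forall_congr' fun x => eq_comm

theorem IsHom.comp {g : V' →ₗ[ℝ] V''} {f : V →ₗ[ℝ] V'} (hg : IsHom A' A'' g) (hf : IsHom A A' f) :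
    IsHom A A'' (g ∘ₗ f) := fun s x => by simp [hf s x, hg s]

theorem IsHom.mul {f g : Module.End ℝ V} (hf : IsHom A A f) (hg : IsHom A A g) :
    IsHom A A (f * g) := hf.comp hg

theorem IsHom.add {f g : V →ₗ[ℝ] V'} (hf : IsHom A A' f) (hg : IsHom A A' g) :
    IsHom A A' (f + g) := fun s x => by simp [hf s x, hg s x]

theorem IsHom.sub {f g : V →ₗ[ℝ] V'} (hf : IsHom A A' f) (hg : IsHom A A' g) :
    IsHom A A' (f - g) := fun s x => by simp [hf s x, hg s x]

theorem IsHom.smul {f : V →ₗ[ℝ] V'} (hf : IsHom A A' f) (c : ℝ) :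
    IsHom A A' (c • f) := fun s x => by simp [hf s x]

theorem isHom_zero : IsHom A A' 0 := fun s x => by simp

theorem isHom_one : IsHom A A 1 := fun _ _ => rfl

theorem isHom_subtype {U : Submodule ℝ V} (hU : IsSubrep A U) :
    IsHom (restrict A U hU) A U.subtype := fun _ _ => rfl

theorem IsHom.pow {f : Module.End ℝ V} (hf : IsHom A A f) (n : ℕ) : IsHom A A (f ^ n) :=
  mem_endAlgebra_iff.1 (pow_mem (mem_endAlgebra_iff.2 hf) n)

theorem IsHom.sum {ι : Type*} {f : ι → V →ₗ[ℝ] V'} (s : Finset ι) (hf : ∀ i, IsHom A A' (f i)) :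
    IsHom A A' (∑ i ∈ s, f i) := by
  classical
  induction s using Finset.induction_on with
  | empty => simpa using isHom_zero
  | insert i s hi ih => rw [Finset.sum_insert hi]; exact (hf i).add ih

theorem IsHom.ker {f : V →ₗ[ℝ] V'} (hf : IsHom A A' f) : IsSubrep A (LinearMap.ker f) := by
  intro s x hx
  rw [LinearMap.mem_ker] at hx ⊢
  rw [hf, hx, map_zero]

theorem IsHom.range {f : V →ₗ[ℝ] V'} (hf : IsHom A A' f) : IsSubrep A' (LinearMap.range f) := by
  rintro s _ ⟨x, rfl⟩
  exact ⟨A s x, hf s x⟩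

theorem IsHom.symm {e : V ≃ₗ[ℝ] V'} (he : IsHom A A' (e : V →ₗ[ℝ] V')) :
    IsHom A' A (e.symm : V' →ₗ[ℝ] V) := fun s x => by
  apply e.injective
  simpa using (he s (e.symm x)).symm

theorem IsHom.of_mul_eq_one {f g : Module.End ℝ V} (hf : IsHom A A f) (hgf : g * f = 1)
    (hfg : f * g = 1) : IsHom A A g := fun s x => by
  have h1 (y : V) : g (f y) = y := LinearMap.congr_fun hgf y
  have h2 (y : V) : f (g y) = y := LinearMap.congr_fun hfg y
  rw [← h1 (A s (g x)), hf, h2]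

theorem IsHom.exists_inv {f : Module.End ℝ V} (hf : IsHom A A f) (hu : IsUnit f) :
    ∃ g : Module.End ℝ V, IsHom A A g ∧ g * f = 1 ∧ f * g = 1 := by
  obtain ⟨u, rfl⟩ := hu
  exact ⟨_, hf.of_mul_eq_one u.inv_mul u.mul_inv, u.inv_mul, u.mul_inv⟩

theorem Isomorphic.symm (h : Isomorphic A A') : Isomorphic A' A :=
  let ⟨e, he⟩ := h
  ⟨e.symm, IsHom.symm he⟩

/-- The projection along a decomposition into two subspaces that are stable under a linear map
commutes with that map. -/
theorem projection_comm {U R : Submodule ℝ V} (h : IsCompl U R) {T : Module.End ℝ V}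
    (hU : ∀ x ∈ U, T x ∈ U) (hR : ∀ x ∈ R, T x ∈ R) (x : V) :
    U.projection R h (T x) = T (U.projection R h x) := by
  conv_lhs => rw [← Submodule.projection_add_projection_eq_self h x]
  rw [map_add, map_add,
    Submodule.projection_apply_of_mem_left h (hU _ (Submodule.projection_apply_mem h x)),
    Submodule.projection_apply_of_mem_right h (hR _ (Submodule.projection_apply_mem h.symm x)),
    add_zero]

end Hom

section Indecomposable

variable {S : Type*} [Semigroup S] {V V' : Type*} [AddCommGroup V] [Module ℝ V]
  [AddCommGroup V'] [Module ℝ V'] {A : S →ₙ* Module.End ℝ V} {A' : S →ₙ* Module.End ℝ V'}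

/-- If an invertible endomorphism of a nonzero `V` factors through an indecomposable
representation, then `V` is a nonzero direct summand of it, hence all of it. -/
theorem IsIndecomposable.bijective_of_isUnit_comp [Nontrivial V] (hA' : IsIndecomposable A')
    {f : V →ₗ[ℝ] V'} {g : V' →ₗ[ℝ] V} (hf : IsHom A A' f) (hg : IsHom A' A g)
    (hu : IsUnit (g ∘ₗ f : Module.End ℝ V)) : Function.Bijective g := by
  have hb := (Module.End.isUnit_iff _).1 hu
  have hc : IsCompl (LinearMap.range f) (LinearMap.ker g) := by
    refine ⟨Submodule.disjoint_def.2 ?_, Submodule.codisjoint_iff_exists_add_eq.2 ?_⟩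
    · rintro _ ⟨x, rfl⟩ hx
      have : x = 0 := hb.1 (by simpa using hx)
      simp [this]
    · intro y
      obtain ⟨x, hx⟩ := hb.2 (g y)
      refine ⟨f x, y - f x, ⟨x, rfl⟩, ?_, by simp⟩
      rw [LinearMap.mem_ker, map_sub, sub_eq_zero]
      exact hx.symm
  rcases hA'.2 _ _ hf.range hg.ker hc with h | h
  · obtain ⟨x, hx⟩ := exists_ne (0 : V)
    refine absurd (hb.1 ?_) hx
    simp [LinearMap.range_eq_bot.1 h]
  · refine ⟨LinearMap.ker_eq_bot.1 h, fun y => ?_⟩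
    obtain ⟨x, hx⟩ := hb.2 y
    exact ⟨f x, hx⟩

theorem isIndecomposable_congr (h : Isomorphic A A') (hA : IsIndecomposable A) :
    IsIndecomposable A' := by
  obtain ⟨e, he⟩ := h
  have := hA.1
  refine ⟨e.symm.toEquiv.nontrivial, fun U U' hU hU' hc => ?_⟩
  have hsub {X : Submodule ℝ V'} (hX : IsSubrep A' X) :
      IsSubrep A (X.map (e.symm : V' →ₗ[ℝ] V)) := by
    rintro s _ ⟨x, hx, rfl⟩
    exact ⟨_, hX s x hx, IsHom.symm he s x⟩
  have hm := hA.2 _ _ (hsub hU) (hsub hU') (hc.map (Submodule.orderIsoMapComap e.symm))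
  simpa using hm

variable [FiniteDimensional ℝ V]

/-- Fitting's lemma: both summands of `V = ker fⁿ ⊕ range fⁿ` are subrepresentations. -/
theorem IsIndecomposable.isNilpotent_or_isUnit (hA : IsIndecomposable A) {f : Module.End ℝ V}
    (hf : IsHom A A f) : IsNilpotent f ∨ IsUnit f := by
  obtain ⟨n, hn, hn0⟩ := ((LinearMap.eventually_isCompl_ker_pow_range_pow f).and
    (Filter.eventually_ne_atTop 0)).exists
  rcases hA.2 _ _ (hf.pow n).ker (hf.pow n).range hn with h | h
  · exact Or.inr ((isUnit_pow_iff hn0).1 ((LinearMap.isUnit_iff_ker_eq_bot _).2 h))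
  · exact Or.inl ⟨n, LinearMap.range_eq_bot.1 h⟩

theorem IsIndecomposable.isomorphic_of_not_isNilpotent_comp (hA : IsIndecomposable A)
    (hA' : IsIndecomposable A') {f : V →ₗ[ℝ] V'} {g : V' →ₗ[ℝ] V} (hf : IsHom A A' f)
    (hg : IsHom A' A g) (h : ¬ IsNilpotent (g ∘ₗ f : Module.End ℝ V)) : Isomorphic A A' := by
  have := hA.1
  have hu := (hA.isNilpotent_or_isUnit (hg.comp hf)).resolve_left h
  exact Isomorphic.symm ⟨LinearEquiv.ofBijective g (hA'.bijective_of_isUnit_comp hf hg hu), hg⟩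

theorem IsIndecomposable.isUnit_of_mul (hA : IsIndecomposable A) {f g : Module.End ℝ V}
    (h : ¬ IsNilpotent (f * g)) (hf : IsHom A A f) (hg : IsHom A A g) : IsUnit f ∧ IsUnit g := by
  have hu := (hA.isNilpotent_or_isUnit (hf.mul hg)).resolve_left h
  have hb := (Module.End.isUnit_iff _).1 hu
  constructor
  · rw [LinearMap.isUnit_iff_range_eq_top, LinearMap.range_eq_top]
    exact fun y => let ⟨x, hx⟩ := hb.2 y; ⟨g x, hx⟩
  · rw [LinearMap.isUnit_iff_ker_eq_bot, LinearMap.ker_eq_bot]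
    exact fun x y hxy => hb.1 (congrArg f hxy)

theorem IsIndecomposable.isNilpotent_mul_right (hA : IsIndecomposable A) {f g : Module.End ℝ V}
    (hf : IsHom A A f) (hg : IsHom A A g) (h : IsNilpotent g) : IsNilpotent (f * g) := by
  have := hA.1
  by_contra hn
  exact h.not_isUnit (hA.isUnit_of_mul hn hf hg).2

theorem IsIndecomposable.isNilpotent_mul_left (hA : IsIndecomposable A) {f g : Module.End ℝ V}
    (hf : IsHom A A f) (hg : IsHom A A g) (h : IsNilpotent f) : IsNilpotent (f * g) := by
  have := hA.1
  by_contra hn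
  exact h.not_isUnit (hA.isUnit_of_mul hn hf hg).1

/-- The endomorphism algebra is local: if `f + g = u` is invertible, then `u⁻¹ f` and
`1 - u⁻¹ f = u⁻¹ g` cannot both be nilpotent. -/
theorem IsIndecomposable.isNilpotent_add (hA : IsIndecomposable A) {f g : Module.End ℝ V}
    (hf : IsHom A A f) (hg : IsHom A A g) (hf' : IsNilpotent f) (hg' : IsNilpotent g) :
    IsNilpotent (f + g) := by
  have := hA.1
  by_contra hn
  obtain ⟨u, hu, h1, -⟩ :=
    (hf.add hg).exists_inv ((hA.isNilpotent_or_isUnit (hf.add hg)).resolve_left hn)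
  have h2 : IsUnit (u * g) := by
    rw [show u * g = 1 - u * f by rw [← h1]; noncomm_ring]
    exact (hA.isNilpotent_mul_right hu hf hf').isUnit_one_sub
  exact (hA.isNilpotent_mul_right hu hg hg').not_isUnit h2

theorem IsIndecomposable.isNilpotent_sum {ι : Type*} (hA : IsIndecomposable A)
    {f : ι → Module.End ℝ V} (s : Finset ι) (hf : ∀ i, IsHom A A (f i))
    (hn : ∀ i ∈ s, IsNilpotent (f i)) : IsNilpotent (∑ i ∈ s, f i) := by
  classical
  induction s using Finset.induction_on with
  | empty => simp
  | insert i s hi ih =>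
    rw [Finset.sum_insert hi]
    exact hA.isNilpotent_add (hf i) (.sum s hf) (hn i (by simp))
      (ih fun j hj => hn j (by simp [hj]))

/-- Absolute indecomposability without the quotient algebra: every endomorphism is a scalar up to a
nilpotent one. -/
theorem isAbsolutelyIndecomposable_iff : IsAbsolutelyIndecomposable A ↔
    IsIndecomposable A ∧
      ∀ L, IsHom A A L → ∃ r : ℝ, IsNilpotent (L - r • (1 : Module.End ℝ V)) := by
  have hval (L : endAlgebra A) : IsNilpotent L ↔ IsNilpotent (L : Module.End ℝ V) :=
    (IsNilpotent.map_iff (f := (endAlgebra A).val) Subtype.val_injective).symm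
  refine and_congr_right fun hA => ⟨?_, fun h => ?_⟩
  · rintro ⟨I, hI, ⟨φ⟩⟩ L hL
    set L' : endAlgebra A := ⟨L, mem_endAlgebra_iff.2 hL⟩
    refine ⟨φ (L' : I.ringCon.Quotient), ?_⟩
    set r := φ (L' : I.ringCon.Quotient)
    have h1 : ((L' : endAlgebra A) : I.ringCon.Quotient) = (algebraMap ℝ (endAlgebra A) r : _) := by
      apply φ.injective
      exact (φ.commutes r).symm
    have h2 : L' - algebraMap ℝ (endAlgebra A) r ∈ I :=
      (TwoSidedIdeal.rel_iff I _ _).1 ((RingCon.eq _).1 h1)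
    have h3 := (hval _).1 ((hI _).1 h2)
    simpa [L', Algebra.algebraMap_eq_smul_one] using h3
  · have hm (L : endAlgebra A) : IsHom A A (L : Module.End ℝ V) := mem_endAlgebra_iff.1 L.2
    let I : TwoSidedIdeal (endAlgebra A) := .mk' {L | IsNilpotent L} IsNilpotent.zero
      (fun {x y} hx hy => (hval _).2
        (hA.isNilpotent_add (hm x) (hm y) ((hval _).1 hx) ((hval _).1 hy)))
      (fun {x} hx => IsNilpotent.neg hx)
      (fun {x y} hy => (hval _).2 (hA.isNilpotent_mul_right (hm x) (hm y) ((hval _).1 hy)))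
      (fun {x y} hx => (hval _).2 (hA.isNilpotent_mul_left (hm x) (hm y) ((hval _).1 hx)))
    have hI (L : endAlgebra A) : L ∈ I ↔ IsNilpotent L := by simp [I]
    have hmem (x y : endAlgebra A) :
        (x : I.ringCon.Quotient) = (y : I.ringCon.Quotient) ↔ IsNilpotent (x - y) := by
      rw [RingCon.eq, ← hI]
      exact TwoSidedIdeal.rel_iff I x y
    refine ⟨I, hI, ⟨(AlgEquiv.ofBijective (Algebra.ofId ℝ I.ringCon.Quotient) ⟨?_, ?_⟩).symm⟩⟩
    · have := hA.1
      have hne : Nontrivial I.ringCon.Quotient := by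
        refine ⟨⟨((1 : endAlgebra A) : I.ringCon.Quotient), ((0 : endAlgebra A) : _),
          fun h10 => ?_⟩⟩
        have := (hmem _ _).1 h10
        rw [sub_zero, hval] at this
        exact this.not_isUnit isUnit_one
      exact (algebraMap ℝ I.ringCon.Quotient).injective
    · intro q
      obtain ⟨L, rfl⟩ := I.ringCon.mk'_surjective q
      obtain ⟨r, hr⟩ := h L (hm L)
      refine ⟨r, ((hmem L (algebraMap ℝ (endAlgebra A) r)).2 ?_).symm⟩
      rw [hval]
      simpa [Algebra.algebraMap_eq_smul_one] using hr

variable [FiniteDimensional ℝ V'] in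
theorem isAbsolutelyIndecomposable_congr (h : Isomorphic A A')
    (hA : IsAbsolutelyIndecomposable A) : IsAbsolutelyIndecomposable A' := by
  rw [isAbsolutelyIndecomposable_iff] at hA ⊢
  refine ⟨isIndecomposable_congr h hA.1, fun L hL => ?_⟩
  obtain ⟨e, he⟩ := h
  have hconj : IsHom A A (e.symm.conj L) := (IsHom.symm he).comp (hL.comp he)
  obtain ⟨r, hr⟩ := hA.2 _ hconj
  refine ⟨r, ?_⟩
  have h1 : e.conjRingEquiv (e.symm.conj L - r • (1 : Module.End ℝ V)) =
      L - r • (1 : Module.End ℝ V') := by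
    refine LinearMap.ext fun x => ?_
    simp [LinearEquiv.conjRingEquiv, LinearEquiv.conj_apply]
  exact h1 ▸ hr.map e.conjRingEquiv

end Indecomposable

/-! ### The Fitting decomposition of an equivariant map -/

section Fitting

variable {S : Type*} [Semigroup S] {W : Type*} [AddCommGroup W] [Module ℝ W]
  {A : S →ₙ* Module.End ℝ W} {L : Module.End ℝ W}

theorem mem_generalizedKernel {x : W} :
    x ∈ generalizedKernel L ↔ ∃ n : ℕ, (L ^ n) x = 0 := by
  simp [generalizedKernel]

theorem isSubrep_generalizedKernel (hL : IsHom A A L) : IsSubrep A (generalizedKernel L) := by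
  intro s x hx
  obtain ⟨n, hn⟩ := mem_generalizedKernel.1 hx
  exact mem_generalizedKernel.2 ⟨n, (hL.pow n).ker s x hn⟩

/-- The generalized kernel of an endomorphism `L` has a complement that is a subrepresentation, and
the projection `p` along it commutes with `L`. As `L` is nilpotent where `p` is the identity and
invertible where `p` vanishes, `L + p` is invertible. -/
theorem exists_isCompl_generalizedKernel [FiniteDimensional ℝ W] (hL : IsHom A A L) :
    ∃ (R : Submodule ℝ W) (hR : IsCompl (generalizedKernel L) R),
      IsHom A A ((generalizedKernel L).projection R hR) ∧
      (∃ n : ℕ, L ^ n * (generalizedKernel L).projection R hR = 0) ∧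
      IsUnit (L + (generalizedKernel L).projection R hR) := by
  obtain ⟨n, hn, hV⟩ := ((LinearMap.eventually_isCompl_ker_pow_range_pow L).and
    (LinearMap.eventually_iSup_ker_pow_eq L)).exists
  have hgk : generalizedKernel L = LinearMap.ker (L ^ n) := by
    rw [← hV]
    ext x
    rw [mem_generalizedKernel, Submodule.mem_iSup_of_directed]
    · rfl
    · exact (LinearMap.iterateKer L).monotone.directed_le
  have hc : IsCompl (generalizedKernel L) (LinearMap.range (L ^ n)) := hgk ▸ hn
  have hmem (x : W) : (L ^ n) ((generalizedKernel L).projection _ hc x) = 0 :=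
    LinearMap.mem_ker.1 (hgk.le (Submodule.projection_apply_mem hc x))
  have hcommL (x : W) : (generalizedKernel L).projection _ hc (L x) =
      L ((generalizedKernel L).projection _ hc x) := by
    refine projection_comm hc (fun y hy => ?_) ?_ x
    · rw [hgk, LinearMap.mem_ker] at hy ⊢
      rw [← Module.End.mul_apply, ← pow_succ, pow_succ', Module.End.mul_apply, hy, map_zero]
    · rintro _ ⟨y, rfl⟩
      exact ⟨L y, by rw [← Module.End.mul_apply, ← Module.End.mul_apply, ← pow_succ, pow_succ']⟩
  refine ⟨_, hc, fun s x => projection_comm hc (isSubrep_generalizedKernel hL s)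
    ((hL.pow n).range s) x, ⟨n, LinearMap.ext hmem⟩, ?_⟩
  rw [LinearMap.isUnit_iff_ker_eq_bot, LinearMap.ker_eq_bot']
  intro x hx
  set y := (generalizedKernel L).projection _ hc x with hy
  have hx' : L x = -y := eq_neg_of_add_eq_zero_left hx
  -- the equation `L x + p x = 0` gives `L y = -y` for `y = p x`, and `L` is nilpotent at `y`
  have hLy : L y = -y := by
    rw [hy, ← hcommL, hx', map_neg, Submodule.projection_apply_of_mem_left hc
      (Submodule.projection_apply_mem hc x)]
  have hpow (k : ℕ) : (L ^ k) y = (-1 : ℝ) ^ k • y := by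
    induction k with
    | zero => simp
    | succ k ih => rw [pow_succ, Module.End.mul_apply, hLy, map_neg, ih, pow_succ]; simp
  have hy0 : y = 0 := by
    have := hmem x
    rw [← hy, hpow] at this
    exact (smul_eq_zero.1 this).resolve_left (by simp)
  have hxk : x ∈ generalizedKernel L := mem_generalizedKernel.2 ⟨1, by simp [hx', hy0]⟩
  rw [← Submodule.projection_apply_of_mem_left hc hxk, ← hy, hy0]

end Fitting

/-! ### Diagonal blocks of equivariant maps -/

section Blocks

variable {S : Type*} [Semigroup S] {W : Type*} [AddCommGroup W] [Module ℝ W]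
  {ι : Type*} [DecidableEq ι]

/-- The subspaces `U i` are a Krull–Schmidt decomposition of `W` without repetitions: `W` is the
direct sum of the `U i`, which are indecomposable and mutually non-isomorphic subrepresentations. -/
structure IsMultiplicityFree (A : S →ₙ* Module.End ℝ W) (U : ι → Submodule ℝ W)
    (hU : ∀ i, IsSubrep A (U i)) : Prop where
  isInternal : DirectSum.IsInternal U
  isIndecomposable : ∀ i, IsIndecomposable (restrict A (U i) (hU i))
  not_isomorphic : ∀ i j, i ≠ j →
    ¬ Isomorphic (restrict A (U i) (hU i)) (restrict A (U j) (hU j))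

/-- The projection of an internal direct sum onto its `i`-th summand. -/
noncomputable def summandProj {U : ι → Submodule ℝ W} (h : DirectSum.IsInternal U) (i : ι) :
    W →ₗ[ℝ] U i :=
  DirectSum.component ℝ ι (fun i => U i) i ∘ₗ
    (LinearEquiv.ofBijective (DirectSum.coeLinearMap U) h).symm

/-- The `i`-th diagonal block of a linear map with respect to an internal direct sum. -/
noncomputable def diagBlock {U : ι → Submodule ℝ W} (h : DirectSum.IsInternal U) (i : ι) :
    Module.End ℝ W →ₗ[ℝ] Module.End ℝ (U i) where
  toFun L := summandProj h i ∘ₗ L ∘ₗ (U i).subtype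
  map_add' L M := by ext; simp
  map_smul' c L := by ext; simp

variable {A : S →ₙ* Module.End ℝ W} {U : ι → Submodule ℝ W} {hU : ∀ i, IsSubrep A (U i)}

theorem summandProj_apply_coe (h : DirectSum.IsInternal U) (i j : ι) (x : U j) :
    (summandProj h i x : W) = if i = j then (x : W) else 0 := by
  have hx : (LinearEquiv.ofBijective (DirectSum.coeLinearMap U) h).symm (x : W) =
      DirectSum.lof ℝ ι (fun i => U i) j x := by
    rw [LinearEquiv.symm_apply_eq]
    exact (DirectSum.coeLinearMap_lof U j x).symm
  rw [summandProj, LinearMap.comp_apply, LinearEquiv.coe_coe, hx]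
  by_cases hij : i = j
  · subst hij
    simp [DirectSum.component.lof_self]
  · rw [if_neg hij, DirectSum.component.of, dif_neg (Ne.symm hij)]
    rfl

theorem summandProj_comp_subtype (h : DirectSum.IsInternal U) (i : ι) :
    summandProj h i ∘ₗ (U i).subtype = LinearMap.id :=
  LinearMap.ext fun x => Subtype.ext (by simp [summandProj_apply_coe])

theorem diagBlock_one (h : DirectSum.IsInternal U) (i : ι) :
    diagBlock h i (1 : Module.End ℝ W) = 1 := summandProj_comp_subtype h i

variable [Fintype ι]

theorem sum_summandProj (h : DirectSum.IsInternal U) :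
    ∑ i, (U i).subtype ∘ₗ summandProj h i = (1 : Module.End ℝ W) := by
  ext x
  obtain ⟨y, rfl⟩ := h.2 x
  induction y using DirectSum.induction_on with
  | zero => simp
  | of j u =>
    rw [show DirectSum.coeAddMonoidHom U (DirectSum.of (fun i => U i) j u) = u by simp]
    simp [LinearMap.sum_apply, summandProj_apply_coe]
  | add y z hy hz => rw [map_add, map_add, hy, hz, map_add]

theorem isHom_summandProj (h : DirectSum.IsInternal U) (i : ι) :
    IsHom A (restrict A (U i) (hU i)) (summandProj h i) := by
  intro s x
  have hx : ∑ j, (summandProj h j x : W) = x := by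
    simpa [LinearMap.sum_apply] using LinearMap.congr_fun (sum_summandProj h) x
  conv_lhs => rw [← hx]
  rw [map_sum, map_sum]
  refine Subtype.ext ?_
  have hj (j : ι) : (summandProj h i (A s (summandProj h j x : W)) : W) =
      if i = j then A s (summandProj h j x : W) else 0 :=
    summandProj_apply_coe h i j ⟨_, hU j s _ (summandProj h j x).2⟩
  rw [AddSubmonoidClass.coe_finsetSum]
  simp_rw [hj]
  simp
  rfl

theorem isHom_diagBlock (h : DirectSum.IsInternal U) (i : ι) {L : Module.End ℝ W}
    (hL : IsHom A A L) : IsHom (restrict A (U i) (hU i)) (restrict A (U i) (hU i))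
      (diagBlock h i L) :=
  (isHom_summandProj h i).comp (hL.comp (isHom_subtype (hU i)))

theorem diagBlock_mul (h : DirectSum.IsInternal U) (i : ι) (L M : Module.End ℝ W) :
    diagBlock h i (L * M) = ∑ k, (summandProj h i ∘ₗ L ∘ₗ (U k).subtype) ∘ₗ
      (summandProj h k ∘ₗ M ∘ₗ (U i).subtype) := by
  have h1 : L * M = ∑ k, L * ((U k).subtype ∘ₗ summandProj h k) * M := by
    rw [← Finset.sum_mul, ← Finset.mul_sum, sum_summandProj, mul_one]
  rw [h1, map_sum]
  rfl

theorem trace_eq_sum_diagBlock [FiniteDimensional ℝ W] (h : DirectSum.IsInternal U)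
    (L : Module.End ℝ W) :
    LinearMap.trace ℝ W L = ∑ i, LinearMap.trace ℝ (U i) (diagBlock h i L) := by
  have h1 : L = ∑ i, (L ∘ₗ (U i).subtype) ∘ₗ summandProj h i := by
    conv_lhs => rw [← mul_one L, ← sum_summandProj h, Finset.mul_sum]
    rfl
  conv_lhs => rw [h1, map_sum]
  exact Finset.sum_congr rfl fun i _ => LinearMap.trace_comp_comm' _ _

variable [FiniteDimensional ℝ W]

namespace IsMultiplicityFree

/-- The equivariant maps whose `i`-th diagonal block is nilpotent. They form a subspace since the
endomorphism algebra of an indecomposable representation is local. -/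
def nilBlock (h : IsMultiplicityFree A U hU) (i : ι) : Submodule ℝ (Module.End ℝ W) where
  carrier := {L | IsHom A A L ∧ IsNilpotent (diagBlock h.isInternal i L)}
  zero_mem' := ⟨isHom_zero, by rw [map_zero]; exact IsNilpotent.zero⟩
  add_mem' := fun {L M} hL hM => ⟨hL.1.add hM.1, by
    rw [map_add]
    exact (h.isIndecomposable i).isNilpotent_add (isHom_diagBlock _ i hL.1)
      (isHom_diagBlock _ i hM.1) hL.2 hM.2⟩
  smul_mem' := fun c L hL => ⟨hL.1.smul c, by
    rw [map_smul]
    exact hL.2.smul c⟩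

variable (h : IsMultiplicityFree A U hU) {i : ι} {L M : Module.End ℝ W}

theorem mem_nilBlock : L ∈ h.nilBlock i ↔
    IsHom A A L ∧ IsNilpotent (diagBlock h.isInternal i L) := Iff.rfl

theorem one_notMem_nilBlock : (1 : Module.End ℝ W) ∉ h.nilBlock i := by
  have := (h.isIndecomposable i).1
  rintro ⟨-, h1⟩
  rw [diagBlock_one] at h1
  exact h1.not_isUnit isUnit_one

/-- Taking the `i`-th diagonal block is multiplicative modulo nilpotent maps, because an
endomorphism of `U i` that factors through some other summand is nilpotent. -/
theorem isNilpotent_diagBlock_mul_sub (hL : IsHom A A L) (hM : IsHom A A M) :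
    IsNilpotent (diagBlock h.isInternal i (L * M) -
      diagBlock h.isInternal i L * diagBlock h.isInternal i M) := by
  have hhom (j k : ι) {T : Module.End ℝ W} (hT : IsHom A A T) :
      IsHom (restrict A (U k) (hU k)) (restrict A (U j) (hU j))
        (summandProj h.isInternal j ∘ₗ T ∘ₗ (U k).subtype) :=
    (isHom_summandProj _ j).comp (hT.comp (isHom_subtype (hU k)))
  rw [diagBlock_mul, ← Finset.add_sum_erase _ _ (Finset.mem_univ i)]
  rw [show diagBlock h.isInternal i L * diagBlock h.isInternal i M =
    (summandProj h.isInternal i ∘ₗ L ∘ₗ (U i).subtype) ∘ₗ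
      (summandProj h.isInternal i ∘ₗ M ∘ₗ (U i).subtype) from rfl, add_sub_cancel_left]
  refine (h.isIndecomposable i).isNilpotent_sum _
    (fun k => (hhom i k hL).comp (hhom k i hM)) fun k hk => ?_
  by_contra hn
  exact h.not_isomorphic i k (Finset.ne_of_mem_erase hk).symm
    ((h.isIndecomposable i).isomorphic_of_not_isNilpotent_comp (h.isIndecomposable k)
      (hhom k i hM) (hhom i k hL) hn)

/-- `nilBlock i` is a prime ideal of the endomorphism algebra. -/
theorem mul_mem_nilBlock_iff (hL : IsHom A A L) (hM : IsHom A A M) :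
    L * M ∈ h.nilBlock i ↔ L ∈ h.nilBlock i ∨ M ∈ h.nilBlock i := by
  have hi := h.isIndecomposable i
  have := hi.1
  have hbL := isHom_diagBlock (hU := hU) h.isInternal i hL
  have hbM := isHom_diagBlock (hU := hU) h.isInternal i hM
  have hbLM := isHom_diagBlock (hU := hU) h.isInternal i (hL.mul hM)
  have hd := h.isNilpotent_diagBlock_mul_sub (i := i) hL hM
  simp only [mem_nilBlock, hL, hM, hL.mul hM, true_and]
  constructor
  · intro hLM
    have hp : IsNilpotent (diagBlock h.isInternal i L * diagBlock h.isInternal i M) := by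
      simpa using hi.isNilpotent_add hbLM ((hbL.mul hbM).sub hbLM) hLM (by simpa using hd.neg)
    rcases hi.isNilpotent_or_isUnit hbL with h1 | h1
    · exact Or.inl h1
    rcases hi.isNilpotent_or_isUnit hbM with h2 | h2
    · exact Or.inr h2
    exact absurd (h1.mul h2) hp.not_isUnit
  · intro hor
    have hp : IsNilpotent (diagBlock h.isInternal i L * diagBlock h.isInternal i M) :=
      hor.elim (hi.isNilpotent_mul_left hbL hbM) (hi.isNilpotent_mul_right hbL hbM)
    simpa using hi.isNilpotent_add (hbLM.sub (hbL.mul hbM)) (hbL.mul hbM) hd hp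

theorem mem_nilBlock_of_pow_mem (hL : IsHom A A L) (n : ℕ) (hn : L ^ n ∈ h.nilBlock i) :
    L ∈ h.nilBlock i := by
  induction n with
  | zero => exact absurd hn h.one_notMem_nilBlock
  | succ n ih =>
    rw [pow_succ, h.mul_mem_nilBlock_iff (hL.pow n) hL] at hn
    exact hn.elim ih id

theorem notMem_nilBlock_of_isUnit (hL : IsHom A A L) (hu : IsUnit L) : L ∉ h.nilBlock i := by
  obtain ⟨M, hM, h1, -⟩ := hL.exists_inv hu
  intro hmem
  exact h.one_notMem_nilBlock (i := i) (h1 ▸ (h.mul_mem_nilBlock_iff hM hL).2 (Or.inr hmem))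

/-- The projection onto the `i`-th summand, as an endomorphism of `W`, separates `nilBlock i` from
the other `nilBlock j`. -/
theorem summandProj_mem_nilBlock_iff {i j : ι} :
    (U i).subtype ∘ₗ summandProj h.isInternal i ∈ h.nilBlock j ↔ j ≠ i := by
  constructor
  · rintro hm rfl
    have := (h.isIndecomposable j).1
    have h1 : diagBlock h.isInternal j ((U j).subtype ∘ₗ summandProj h.isInternal j) = 1 :=
      LinearMap.ext fun x => Subtype.ext (by simp [diagBlock, summandProj_apply_coe])
    exact (h1 ▸ hm.2).not_isUnit isUnit_one
  · intro hji
    refine ⟨(isHom_subtype (hU i)).comp (isHom_summandProj _ i), ?_⟩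
    have h0 : diagBlock h.isInternal j ((U i).subtype ∘ₗ summandProj h.isInternal i) = 0 :=
      LinearMap.ext fun x => Subtype.ext (by simp [diagBlock, summandProj_apply_coe, hji.symm])
    exact h0 ▸ IsNilpotent.zero

/-- If modulo `nilBlock i` there are only scalars, then `U i` is absolutely indecomposable. -/
theorem isAbsolutelyIndecomposable_of_forall_exists
    (hs : ∀ L, IsHom A A L → ∃ r : ℝ, L - r • (1 : Module.End ℝ W) ∈ h.nilBlock i) :
    IsAbsolutelyIndecomposable (restrict A (U i) (hU i)) := by
  refine isAbsolutelyIndecomposable_iff.2 ⟨h.isIndecomposable i, fun f hf => ?_⟩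
  obtain ⟨r, hr⟩ := hs ((U i).subtype ∘ₗ f ∘ₗ summandProj h.isInternal i)
    ((isHom_subtype (hU i)).comp (hf.comp (isHom_summandProj _ i)))
  have hb : diagBlock h.isInternal i ((U i).subtype ∘ₗ f ∘ₗ summandProj h.isInternal i) = f := by
    have := summandProj_comp_subtype h.isInternal i
    refine LinearMap.ext fun x => ?_
    have hx (y : U i) : summandProj h.isInternal i (y : W) = y := LinearMap.congr_fun this y
    simp [diagBlock, hx]
  refine ⟨r, ?_⟩
  have := hr.2
  rwa [map_sub, map_smul, diagBlock_one, hb] at this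

/-- Modulo the prime ideal `nilBlock i`, the projection `p` onto the generalized kernel of `L` is
`1` if `L` is in the ideal and `0` otherwise. -/
theorem projection_mem_nilBlock_iff {p : Module.End ℝ W} (hL : IsHom A A L) (hp : IsHom A A p)
    (hn : ∃ n : ℕ, L ^ n * p = 0) (hu : IsUnit (L + p)) :
    p ∈ h.nilBlock i ↔ L ∉ h.nilBlock i := by
  constructor
  · intro h1 h2
    exact h.notMem_nilBlock_of_isUnit (hL.add hp) hu (add_mem h2 h1)
  · intro h1
    obtain ⟨n, hn⟩ := hn
    have h2 : L ^ n * p ∈ h.nilBlock i := hn ▸ zero_mem _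
    exact ((h.mul_mem_nilBlock_iff (hL.pow n) hp).1 h2).resolve_left
      fun h3 => h1 (h.mem_nilBlock_of_pow_mem hL n h3)

/-- The trace of the projection onto the generalized kernel, computed block by block. -/
theorem finrank_generalizedKernel [∀ i, Decidable (L ∈ h.nilBlock i)] (hL : IsHom A A L) :
    Module.finrank ℝ (generalizedKernel L) =
      ∑ i, if L ∈ h.nilBlock i then Module.finrank ℝ (U i) else 0 := by
  obtain ⟨R, hR, hp, hn, hu⟩ := exists_isCompl_generalizedKernel hL
  set p := (generalizedKernel L).projection R hR
  have hproj : LinearMap.IsProj (generalizedKernel L) p :=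
    ⟨Submodule.projection_apply_mem hR, fun x hx => Submodule.projection_apply_of_mem_left hR hx⟩
  have hpp : (1 - p) * p = 0 := by
    rw [sub_mul, one_mul, (Submodule.isIdempotentElem_projection hR).eq, sub_self]
  have ht := hproj.trace
  rw [trace_eq_sum_diagBlock h.isInternal] at ht
  have hb (i : ι) : LinearMap.trace ℝ (U i) (diagBlock h.isInternal i p) =
      ((if L ∈ h.nilBlock i then Module.finrank ℝ (U i) else 0 : ℕ) : ℝ) := by
    have hiff := h.projection_mem_nilBlock_iff (i := i) hL hp hn hu
    split_ifs with hi
    · have h1 : 1 - p ∈ h.nilBlock i :=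
        ((h.mul_mem_nilBlock_iff (i := i) (isHom_one.sub hp) hp).1
          (hpp ▸ zero_mem _)).resolve_right fun hpi => hiff.1 hpi hi
      have h2 := (LinearMap.isNilpotent_trace_of_isNilpotent h1.2).eq_zero
      rw [map_sub, diagBlock_one, map_sub, LinearMap.trace_one, sub_eq_zero] at h2
      exact h2.symm
    · rw [(LinearMap.isNilpotent_trace_of_isNilpotent (hiff.2 hi).2).eq_zero, Nat.cast_zero]
  rw [Finset.sum_congr rfl fun i _ => hb i] at ht
  exact_mod_cast ht.symm

/-- If `L ∈ nilBlock i`, then `U i` is a direct summand of the generalized kernel of `L`. -/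
theorem exists_isUnit_comp (hL : IsHom A A L) (hi : L ∈ h.nilBlock i) :
    ∃ (f : U i →ₗ[ℝ] generalizedKernel L) (g : generalizedKernel L →ₗ[ℝ] U i),
      IsHom (restrict A (U i) (hU i)) (restrict A _ (isSubrep_generalizedKernel hL)) f ∧
      IsHom (restrict A _ (isSubrep_generalizedKernel hL)) (restrict A (U i) (hU i)) g ∧
      IsUnit (g ∘ₗ f : Module.End ℝ (U i)) := by
  obtain ⟨R, hR, hp, hn, hu⟩ := exists_isCompl_generalizedKernel hL
  have hpi := fun hpi => (h.projection_mem_nilBlock_iff (i := i) hL hp hn hu).1 hpi hi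
  refine ⟨(generalizedKernel L).projectionOnto R hR ∘ₗ (U i).subtype,
    summandProj h.isInternal i ∘ₗ (generalizedKernel L).subtype,
    fun s x => Subtype.ext (hp s x), (isHom_summandProj _ i).comp (isHom_subtype _), ?_⟩
  exact ((h.isIndecomposable i).isNilpotent_or_isUnit (isHom_diagBlock _ i hp)).resolve_left
    fun h1 => hpi ⟨hp, h1⟩

theorem isomorphic_generalizedKernel (hL : IsHom A A L) (hi : L ∈ h.nilBlock i)
    (huniq : ∀ j, L ∈ h.nilBlock j → j = i) :
    Isomorphic (restrict A (U i) (hU i)) (restrict A _ (isSubrep_generalizedKernel hL)) := by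
  classical
  obtain ⟨f, g, hf, -, hu⟩ := h.exists_isUnit_comp hL hi
  have hinj : Function.Injective f := fun x y hxy =>
    ((Module.End.isUnit_iff _).1 hu).1 (congrArg g hxy)
  have hdim : Module.finrank ℝ (U i) = Module.finrank ℝ (generalizedKernel L) := by
    rw [h.finrank_generalizedKernel hL, Finset.sum_eq_single i, if_pos hi]
    · exact fun j _ hj => if_neg fun hmem => hj (huniq j hmem)
    · simp
  exact ⟨LinearMap.linearEquivOfInjective f hinj hdim, hf⟩

/-- The generalized kernel of `L` is trivial or absolutely indecomposable exactly if `L` avoids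
the intersections of two of the ideals `nilBlock i`, and those `nilBlock i` for which `U i` is not
absolutely indecomposable. -/
theorem generalizedKernel_eq_bot_or_iff (hL : IsHom A A L) :
    (generalizedKernel L = ⊥ ∨ ∃ hV : IsSubrep A (generalizedKernel L),
      IsAbsolutelyIndecomposable (restrict A (generalizedKernel L) hV)) ↔
    (∀ i j, i ≠ j → ¬ (L ∈ h.nilBlock i ∧ L ∈ h.nilBlock j)) ∧
      ∀ i, L ∈ h.nilBlock i → IsAbsolutelyIndecomposable (restrict A (U i) (hU i)) := by
  classical
  have hpos (i : ι) : 0 < Module.finrank ℝ (U i) := by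
    have := (h.isIndecomposable i).1
    exact Module.finrank_pos
  have hdim := h.finrank_generalizedKernel hL
  constructor
  · rintro (h0 | ⟨hV, hV'⟩)
    · rw [h0, finrank_bot] at hdim
      have hnone (i : ι) : L ∉ h.nilBlock i := fun hi => by
        have := (Finset.sum_eq_zero_iff.1 hdim.symm) i (Finset.mem_univ i)
        rw [if_pos hi] at this
        exact (hpos i).ne' this
      exact ⟨fun i j _ hij => hnone i hij.1, fun i hi => absurd hi (hnone i)⟩
    · -- the indecomposable generalized kernel has no proper direct summand
      have hiso (i : ι) (hi : L ∈ h.nilBlock i) :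
          Isomorphic (restrict A _ hV) (restrict A (U i) (hU i)) := by
        obtain ⟨f, g, hf, hg, hu⟩ := h.exists_isUnit_comp hL hi
        have := (h.isIndecomposable i).1
        exact ⟨LinearEquiv.ofBijective g (hV'.1.bijective_of_isUnit_comp hf hg hu), hg⟩
      refine ⟨fun i j hij hmem => ?_, fun i hi => isAbsolutelyIndecomposable_congr (hiso i hi) hV'⟩
      obtain ⟨e, -⟩ := hiso i hmem.1
      have hle : Module.finrank ℝ (U i) + Module.finrank ℝ (U j) ≤
          Module.finrank ℝ (generalizedKernel L) := by
        rw [hdim, ← Finset.add_sum_erase _ _ (Finset.mem_univ i), if_pos hmem.1]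
        have := Finset.single_le_sum
          (f := fun k => if L ∈ h.nilBlock k then Module.finrank ℝ (U k) else 0)
          (fun _ _ => Nat.zero_le _)
          (Finset.mem_erase.2 ⟨hij.symm, Finset.mem_univ j⟩)
        rw [if_pos hmem.2] at this
        exact Nat.add_le_add_left this _
      have := e.finrank_eq
      have := hpos j
      omega
  · rintro ⟨h1, h2⟩
    by_cases hex : ∃ i, L ∈ h.nilBlock i
    · obtain ⟨i, hi⟩ := hex
      refine Or.inr ⟨isSubrep_generalizedKernel hL, isAbsolutelyIndecomposable_congr
        (h.isomorphic_generalizedKernel hL hi fun j hj => ?_) (h2 i hi)⟩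
      by_contra hji
      exact h1 j i hji ⟨hj, hi⟩
    · push Not at hex
      refine Or.inl (Submodule.finrank_eq_zero.1 ?_)
      rw [hdim]
      exact Finset.sum_eq_zero fun i _ => if_neg (hex i)

end IsMultiplicityFree

end Blocks

/-! ### Translating a curve off subspaces of codimension two -/

section Avoidance

open Module

theorem finrank_add_two_le {E : Type*} [AddCommGroup E] [Module ℝ E] [FiniteDimensional ℝ E]
    {B : Submodule ℝ E} {u v : E} (h : ∀ r s : ℝ, r • u + s • v ∈ B → r = 0 ∧ s = 0) :
    finrank ℝ B + 2 ≤ finrank ℝ E := by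
  have hli : LinearIndependent ℝ ![B.mkQ u, B.mkQ v] := by
    refine LinearIndependent.pair_iff.2 fun r s hrs => h r s ?_
    rwa [← map_smul, ← map_smul, ← map_add, Submodule.mkQ_apply, Submodule.Quotient.mk_eq_zero]
      at hrs
  have h2 := hli.fintype_card_le_finrank
  rw [Fintype.card_fin] at h2
  have := B.finrank_quotient_add_finrank
  omega

variable {E : Type*} [NormedAddCommGroup E] [NormedSpace ℝ E] [FiniteDimensional ℝ E]

/-- The translations that fail are the differences of a point of some `B k` and a point of the
curve, and these form a countable union of smooth images of the spaces `B k × ℝ`, whose dimension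
is less than that of `E`. -/
theorem dense_forall_add_notMem {κ : Type*} [Countable κ] (B : κ → Submodule ℝ E)
    (hB : ∀ k, finrank ℝ (B k) + 2 ≤ finrank ℝ E) {M : ℝ → E} {a b : ℝ}
    (hM : ContDiffOn ℝ 1 M (Set.Ioo a b)) :
    Dense {e : E | ∀ t ∈ Set.Ioo a b, ∀ k, M t + e ∉ B k} := by
  rcases isEmpty_or_nonempty κ with hκ | ⟨⟨k₀⟩⟩
  · simp
  let F (k : κ) (x : B k × ℝ) : E := (x.1 : E) - M x.2
  have hF (k : κ) : ContDiffOn ℝ 1 (F k) (Set.univ ×ˢ Set.Ioo a b) := by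
    refine ContDiffOn.sub ?_ (hM.comp contDiffOn_snd fun x hx => hx.2)
    exact ((B k).subtypeL.contDiff.comp contDiff_fst).contDiffOn
  have hdim : dimH (⋃ k, F k '' (Set.univ ×ˢ Set.Ioo a b)) < finrank ℝ E := by
    have hle : dimH (⋃ k, F k '' (Set.univ ×ˢ Set.Ioo a b)) ≤
        ((finrank ℝ E - 1 : ℕ) : ENNReal) := by
      rw [dimH_iUnion]
      refine iSup_le fun k => ?_
      refine ((hF k).dimH_image_le (convex_univ.prod (convex_Ioo a b)) subset_rfl).trans ?_
      refine (dimH_mono (Set.subset_univ _)).trans ?_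
      rw [Real.dimH_univ_eq_finrank, finrank_prod, finrank_self]
      have := hB k
      exact_mod_cast (by omega : finrank ℝ (B k) + 1 ≤ finrank ℝ E - 1)
    refine hle.trans_lt ?_
    have := hB k₀
    exact_mod_cast (by omega : finrank ℝ E - 1 < finrank ℝ E)
  refine (dense_compl_of_dimH_lt_finrank hdim).mono
    fun e he t ht k hk => Set.notMem_of_mem_compl he ?_
  exact Set.mem_iUnion.2 ⟨k, (⟨M t + e, hk⟩, t), ⟨trivial, ht⟩, by simp [F]⟩

/-- A curve in a subspace `C` is translated off subspaces of codimension at least two in `C` by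
some element of norm at most one. -/
theorem exists_norm_le_one_forall_add_notMem {κ : Type*} [Countable κ] (C : Submodule ℝ E)
    (B : κ → Submodule ℝ E) (hB : ∀ k, finrank ℝ ((B k).comap C.subtype) + 2 ≤ finrank ℝ C)
    {M : ℝ → E} {a b : ℝ} (hM : ContDiffOn ℝ 1 M (Set.Ioo a b))
    (hMC : ∀ t ∈ Set.Ioo a b, M t ∈ C) :
    ∃ e : C, ‖e‖ ≤ 1 ∧ ∀ t ∈ Set.Ioo a b, ∀ k, M t + e ∉ B k := by
  obtain ⟨p, hp⟩ := C.subtype.exists_leftInverse_of_injective C.ker_subtype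
  let proj : E →L[ℝ] C := LinearMap.toContinuousLinearMap p
  have hproj (x : E) (hx : x ∈ C) : (proj x : E) = x :=
    congrArg Subtype.val (LinearMap.congr_fun hp ⟨x, hx⟩)
  have hpM : ContDiffOn ℝ 1 (fun t => proj (M t)) (Set.Ioo a b) :=
    proj.contDiff.comp_contDiffOn hM
  obtain ⟨e, he, he1⟩ := (dense_forall_add_notMem _ hB hpM).exists_dist_lt (0 : C) one_pos
  rw [dist_zero_left] at he1
  refine ⟨e, he1.le, fun t ht k hk => he t ht k ?_⟩
  rw [Submodule.mem_comap, Submodule.subtype_apply, Submodule.coe_add, hproj _ (hMC t ht)]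
  exact hk

end Avoidance

/-! ### Smooth functions below a prescribed gauge -/

section Gauge

open Set Function

/-- On an open set there is a positive smooth function, vanishing outside, which together with its
derivative is bounded by a given positive continuous function. It is a sum of countably many bump
functions, the `n`-th of which is scaled to make its derivatives up to order `n + 1` small in
comparison with `ε`. -/
theorem exists_contDiff_pos_le_gauge {E : Type*} [NormedAddCommGroup E] [NormedSpace ℝ E]
    [FiniteDimensional ℝ E] {s : Set E} (hs : IsOpen s) {ε : E → ℝ} (hε : ContinuousOn ε s)
    (hpos : ∀ x ∈ s, 0 < ε x) :
    ∃ ρ : E → ℝ, ContDiff ℝ ∞ ρ ∧ (∀ x ∈ s, 0 < ρ x) ∧ (∀ x ∉ s, ρ x = 0) ∧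
      ∀ x ∈ s, |ρ x| ≤ ε x ∧ ‖fderiv ℝ ρ x‖ ≤ ε x := by
  rcases s.eq_empty_or_nonempty with rfl | hne
  · exact ⟨0, contDiff_const, by simp, by simp, by simp⟩
  have hbump (x : s) : ∃ f : E → ℝ, tsupport f ⊆ s ∧ HasCompactSupport f ∧ ContDiff ℝ ∞ f ∧
      range f ⊆ Icc 0 1 ∧ f x = 1 := exists_contDiff_tsupport_subset (hs.mem_nhds x.2)
  choose f f_supp f_comp f_smooth f_range f_one using hbump
  -- countably many of the bump functions have supports that cover `s`
  obtain ⟨T, hTc, hT⟩ : ∃ T : Set s, T.Countable ∧ ⋃ x ∈ T, support (f x) = ⋃ x, support (f x) :=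
    TopologicalSpace.isOpen_iUnion_countable _ fun x => (f_smooth x).continuous.isOpen_support
  have hcov (x : s) : ∃ y ∈ T, f y x ≠ 0 := by
    have : (x : E) ∈ ⋃ y ∈ T, support (f y) := by
      rw [hT]
      exact mem_iUnion.2 ⟨x, by simp [f_one]⟩
    simpa using this
  have hTne : T.Nonempty := by
    obtain ⟨x, hx⟩ := hne
    obtain ⟨y, hy, -⟩ := hcov ⟨x, hx⟩
    exact ⟨y, hy⟩
  obtain ⟨q, rfl⟩ := hTc.exists_eq_range hTne
  let g (n : ℕ) : E → ℝ := f (q n)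
  have g_smooth (n : ℕ) : ContDiff ℝ ∞ (g n) := f_smooth _
  have g_nonneg (n : ℕ) (x : E) : 0 ≤ g n x := (f_range (q n) (mem_range_self x)).1
  obtain ⟨δ, δpos, c, hδ, hc⟩ :
      ∃ δ : ℕ → NNReal, (∀ i : ℕ, 0 < δ i) ∧ ∃ c : NNReal, HasSum δ c ∧ c < 1 :=
    NNReal.exists_pos_sum_of_countable one_ne_zero ℕ
  have hδ' : HasSum (fun n => (δ n : ℝ)) c := NNReal.hasSum_coe.2 hδ
  have hmin (n : ℕ) : ∃ m : ℝ, 0 < m ∧ m ≤ 1 ∧ ∀ x ∈ tsupport (g n), m ≤ ε x := by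
    have hcont : ContinuousOn ε (tsupport (g n)) := hε.mono (f_supp _)
    obtain ⟨x, hx, hmin⟩ := IsCompact.exists_isMinOn (f_comp (q n))
      ⟨q n, subset_tsupport _ (by simp [f_one])⟩ hcont
    exact ⟨min (ε x) 1, lt_min (hpos x (f_supp _ hx)) one_pos, min_le_right _ _,
      fun y hy => (min_le_left _ _).trans (hmin hy)⟩
  choose m m_pos m_le_one m_le using hmin
  have hscale (n : ℕ) : ∃ r : ℝ, 0 < r ∧
      ∀ k ≤ n + 1, ∀ x, ‖iteratedFDeriv ℝ k (r • g n) x‖ ≤ δ n * m n := by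
    have hbdd (k : ℕ) : ∃ R, ∀ x, ‖iteratedFDeriv ℝ k (g n) x‖ ≤ R := by
      have : BddAbove (range fun x => ‖iteratedFDeriv ℝ k (g n) x‖) := by
        apply ((g_smooth n).continuous_iteratedFDeriv
          (mod_cast le_top)).norm.bddAbove_range_of_hasCompactSupport
        exact HasCompactSupport.comp_left ((f_comp (q n)).iteratedFDeriv k) norm_zero
      obtain ⟨R, hR⟩ := this
      exact ⟨R, fun x => hR (mem_range_self _)⟩
    choose R hR using hbdd
    obtain ⟨M, hM⟩ := ((Finset.range (n + 2)).image R).bddAbove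
    have hpos' : (0 : ℝ) < max M 1 := lt_max_of_lt_right one_pos
    have := δpos n
    have := m_pos n
    refine ⟨(max M 1)⁻¹ * (δ n * m n), by positivity, fun k hk x => ?_⟩
    rw [iteratedFDeriv_const_smul_apply ((g_smooth n).contDiffAt.of_le (mod_cast le_top)),
      norm_smul, Real.norm_of_nonneg (by positivity), mul_assoc, inv_mul_le_iff₀ hpos', mul_comm]
    gcongr
    refine (hR k x).trans (le_max_of_le_left (hM ?_))
    exact Finset.mem_coe.2 (Finset.mem_image_of_mem _ (Finset.mem_range.2 (by omega)))
  choose r r_pos hr using hscale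
  have hrδ (n k : ℕ) (hk : k ≤ n + 1) (x : E) : ‖iteratedFDeriv ℝ k (r n • g n) x‖ ≤ δ n :=
    (hr n k hk x).trans (mul_le_of_le_one_right (δ n).2 (m_le_one n))
  have hrε (n k : ℕ) (hk : k ≤ n + 1) {x : E} (hx : x ∈ s) :
      ‖iteratedFDeriv ℝ k (r n • g n) x‖ ≤ δ n * ε x := by
    by_cases hxn : x ∈ tsupport (g n)
    · exact (hr n k hk x).trans (mul_le_mul_of_nonneg_left (m_le n x hxn) (δ n).2)
    · have h0 : iteratedFDeriv ℝ k (r n • g n) x = 0 := by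
        rw [iteratedFDeriv_const_smul_apply ((g_smooth n).contDiffAt.of_le (mod_cast le_top)),
          image_eq_zero_of_notMem_tsupport fun h => hxn (tsupport_iteratedFDeriv_subset k h),
          smul_zero]
      rw [h0, norm_zero]
      exact mul_nonneg (δ n).2 (hpos x hx).le
  have hrsmooth (n : ℕ) : ContDiff ℝ ∞ (r n • g n) := (g_smooth n).const_smul (r n)
  have hsum (x : E) : Summable fun n => (r n • g n) x :=
    .of_norm_bounded hδ'.summable fun n => by
      simpa only [norm_iteratedFDeriv_zero] using hrδ n 0 (Nat.zero_le _) x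
  have hderiv (k : ℕ) (hk : k ≤ 1) {x : E} (hx : x ∈ s) :
      ‖iteratedFDeriv ℝ k (fun y => ∑' n, (r n • g n) y) x‖ ≤ ε x := by
    rw [iteratedFDeriv_tsum_apply (N := 1) (v := fun _ n => (δ n : ℝ))
      (fun n => (hrsmooth n).of_le (mod_cast le_top)) (fun _ _ => hδ'.summable)
      (fun k n y hk => hrδ n k (by have : k ≤ 1 := by exact_mod_cast hk
                                   omega) y) (mod_cast hk)]
    refine (tsum_of_norm_bounded (hδ'.mul_right (ε x))
      fun n => hrε n k (by omega) hx).trans ?_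
    exact mul_le_of_le_one_left (hpos x hx).le (mod_cast hc.le)
  refine ⟨fun x => ∑' n, (r n • g n) x, ?_, fun x hx => ?_, fun x hx => ?_, fun x hx => ⟨?_, ?_⟩⟩
  · refine contDiff_tsum_of_eventually (v := fun _ n => (δ n : ℝ)) hrsmooth
      (fun _ _ => hδ'.summable) fun k _ => ?_
    rw [Nat.cofinite_eq_atTop]
    filter_upwards [Filter.eventually_ge_atTop k] with n hn x using hrδ n k (by omega) x
  · obtain ⟨_, ⟨n, rfl⟩, hn⟩ := hcov ⟨x, hx⟩
    exact (hsum x).tsum_pos (fun i => mul_nonneg (r_pos i).le (g_nonneg i x)) n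
      (mul_pos (r_pos n) ((g_nonneg n x).lt_of_ne' hn))
  · have h0 (n : ℕ) : g n x = 0 := image_eq_zero_of_notMem_tsupport fun h => hx (f_supp _ h)
    simp [h0]
  · simpa only [norm_iteratedFDeriv_zero, Real.norm_eq_abs] using hderiv 0 (by omega) hx
  · rw [← norm_iteratedFDeriv_one]
    exact hderiv 1 le_rfl hx

end Gauge

/-! ### The degenerate equivariant maps -/

section Degenerate

variable {S : Type*} [Semigroup S] {W : Type*} [NormedAddCommGroup W] [NormedSpace ℝ W]
  [FiniteDimensional ℝ W] {ι : Type*} [Fintype ι] [DecidableEq ι]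
  {A : S →ₙ* Module.End ℝ W} {U : ι → Submodule ℝ W} {hU : ∀ i, IsSubrep A (U i)}

/-- The equivariant linear maps, as a subspace of the normed space of continuous linear maps. -/
def equivariantMaps (A : S →ₙ* Module.End ℝ W) : Submodule ℝ (W →L[ℝ] W) :=
  (Subalgebra.toSubmodule (endAlgebra A)).comap (ContinuousLinearMap.coeLM ℝ)

omit [FiniteDimensional ℝ W] in
theorem mem_equivariantMaps {L : W →L[ℝ] W} :
    L ∈ equivariantMaps A ↔ IsHom A A (L : W →ₗ[ℝ] W) := mem_endAlgebra_iff

namespace IsMultiplicityFree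

variable (h : IsMultiplicityFree A U hU)

/-- The index set for the subspaces of degenerate maps: pairs `(i, j)` with `i ≠ j`, and also the
pairs `(i, i)` for which `U i` is not absolutely indecomposable. -/
abbrev DegenerateIndex (_ : IsMultiplicityFree A U hU) : Type _ :=
  {x : ι × ι // x.1 ≠ x.2 ∨ ¬ IsAbsolutelyIndecomposable (restrict A (U x.1) (hU x.1))}

/-- The subspaces of equivariant maps that are excluded by general position. -/
noncomputable def degenerate (k : h.DegenerateIndex) : Submodule ℝ (W →L[ℝ] W) :=
  (h.nilBlock k.1.1 ⊓ h.nilBlock k.1.2).comap (ContinuousLinearMap.coeLM ℝ)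

theorem mem_degenerate {k : h.DegenerateIndex} {L : W →L[ℝ] W} : L ∈ h.degenerate k ↔
    (L : W →ₗ[ℝ] W) ∈ h.nilBlock k.1.1 ∧ (L : W →ₗ[ℝ] W) ∈ h.nilBlock k.1.2 := Iff.rfl

theorem generalizedKernel_iff_forall_notMem_degenerate {L : W →L[ℝ] W}
    (hL : L ∈ equivariantMaps A) :
    (generalizedKernel (L : W →ₗ[ℝ] W) = ⊥ ∨
      ∃ hV : IsSubrep A (generalizedKernel (L : W →ₗ[ℝ] W)),
        IsAbsolutelyIndecomposable (restrict A (generalizedKernel (L : W →ₗ[ℝ] W)) hV)) ↔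
    ∀ k, L ∉ h.degenerate k := by
  rw [h.generalizedKernel_eq_bot_or_iff (mem_equivariantMaps.1 hL)]
  constructor
  · rintro ⟨h1, h2⟩ ⟨⟨i, j⟩, hk⟩ hmem
    rw [mem_degenerate] at hmem
    exact hk.elim (fun hij => h1 i j hij hmem) (fun hi => hi (h2 i hmem.1))
  · refine fun hk => ⟨fun i j hij hmem => hk ⟨(i, j), Or.inl hij⟩ hmem, fun i hi => ?_⟩
    by_contra hna
    exact hk ⟨(i, i), Or.inr hna⟩ ⟨hi, hi⟩

/-- Each subspace of degenerate maps has codimension at least two. For `i ≠ j` the projections onto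
`U i` and `U j` are independent modulo `nilBlock i ⊓ nilBlock j`. If `U i` is not absolutely
indecomposable, then there are more than scalars modulo `nilBlock i`. -/
theorem finrank_degenerate_add_two_le (k : h.DegenerateIndex) :
    Module.finrank ℝ ((h.degenerate k).comap (equivariantMaps A).subtype) + 2 ≤
      Module.finrank ℝ (equivariantMaps A) := by
  obtain ⟨⟨i, j⟩, hk⟩ := k
  let toEq (L : Module.End ℝ W) (hL : IsHom A A L) : equivariantMaps A :=
    ⟨LinearMap.toContinuousLinearMap L, mem_equivariantMaps.2 hL⟩
  by_cases hij : i = j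
  · subst hij
    have hna := hk.resolve_left (by simp)
    obtain ⟨L, hL, hr⟩ : ∃ L, IsHom A A L ∧
        ∀ r : ℝ, L - r • (1 : Module.End ℝ W) ∉ h.nilBlock i := by
      by_contra! hcon
      exact hna (h.isAbsolutelyIndecomposable_of_forall_exists hcon)
    refine finrank_add_two_le (u := toEq 1 isHom_one) (v := toEq L hL) fun r s hrs => ?_
    have hmem : r • (1 : Module.End ℝ W) + s • L ∈ h.nilBlock i := hrs.1
    have hs : s = 0 := by
      by_contra hs
      refine hr (-(s⁻¹ * r)) ?_
      have := (h.nilBlock i).smul_mem s⁻¹ hmem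
      rwa [smul_add, smul_smul, smul_smul, inv_mul_cancel₀ hs, one_smul, add_comm,
        ← sub_neg_eq_add, ← neg_smul] at this
    refine ⟨?_, hs⟩
    by_contra hr0
    rw [hs, zero_smul, add_zero, Submodule.smul_mem_iff _ hr0] at hmem
    exact h.one_notMem_nilBlock hmem
  · let P (k : ι) : Module.End ℝ W := (U k).subtype ∘ₗ summandProj h.isInternal k
    have hP (k : ι) : IsHom A A (P k) := (isHom_subtype (hU k)).comp (isHom_summandProj _ k)
    refine finrank_add_two_le (u := toEq (P i) (hP i)) (v := toEq (P j) (hP j))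
      fun r s hrs => ⟨?_, ?_⟩
    · have hmem : r • P i + s • P j ∈ h.nilBlock i := hrs.1
      rw [Submodule.add_mem_iff_left _
        (Submodule.smul_mem _ s (h.summandProj_mem_nilBlock_iff.2 hij))] at hmem
      by_contra hr
      exact h.summandProj_mem_nilBlock_iff.1 ((Submodule.smul_mem_iff _ hr).1 hmem) rfl
    · have hmem : r • P i + s • P j ∈ h.nilBlock j := hrs.2
      rw [Submodule.add_mem_iff_right _
        (Submodule.smul_mem _ r (h.summandProj_mem_nilBlock_iff.2 (Ne.symm hij)))] at hmem
      by_contra hs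
      exact h.summandProj_mem_nilBlock_iff.1 ((Submodule.smul_mem_iff _ hs).1 hmem) rfl

end IsMultiplicityFree

end Degenerate

/-! ### Linearizations of equivariant families -/

namespace EquivariantFamily

variable {S : Type*} [Semigroup S] {W : Type*} [NormedAddCommGroup W] [NormedSpace ℝ W]
  {A : S →ₙ* Module.End ℝ W} {X₀ : W} {a b : ℝ}

/-- The linearization `D_X Γ(X₀; t)` as a partial derivative of `Γ`, for `t` in `(a, b)`. -/
noncomputable def partialDeriv (Γ : EquivariantFamily A X₀ a b) (t : ℝ) : W →L[ℝ] W :=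
  (fderiv ℝ Γ.toFun (X₀, t)).comp (ContinuousLinearMap.inl ℝ W ℝ)

variable (Γ : EquivariantFamily A X₀ a b) {t : ℝ}

theorem differentiableAt (X : W) (ht : t ∈ Set.Ioo a b) :
    DifferentiableAt ℝ Γ.toFun (X, t) :=
  (Γ.smooth.contDiffAt ((isOpen_univ.prod isOpen_Ioo).mem_nhds ⟨trivial, ht⟩)).differentiableAt
    (by simp)

theorem hasFDerivAt_partialDeriv (ht : t ∈ Set.Ioo a b) :
    HasFDerivAt (fun X : W => Γ.toFun (X, t)) (Γ.partialDeriv t) X₀ :=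
  (Γ.differentiableAt X₀ ht).hasFDerivAt.comp X₀ (hasFDerivAt_prodMk_left X₀ t)

theorem linearization_eq (ht : t ∈ Set.Ioo a b) :
    Γ.linearization t = (Γ.partialDeriv t : W →ₗ[ℝ] W) := by
  rw [linearization, (Γ.hasFDerivAt_partialDeriv ht).fderiv]

theorem contDiffOn_partialDeriv : ContDiffOn ℝ ∞ Γ.partialDeriv (Set.Ioo a b) := by
  have h1 : ContDiffOn ℝ ∞ (fderiv ℝ Γ.toFun) (Set.univ ×ˢ Set.Ioo a b) :=
    Γ.smooth.fderiv_of_isOpen (isOpen_univ.prod isOpen_Ioo) (by simp)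
  have h2 : ContDiffOn ℝ ∞ (fun t : ℝ => fderiv ℝ Γ.toFun (X₀, t)) (Set.Ioo a b) :=
    h1.comp (contDiff_prodMk_right X₀).contDiffOn fun t ht => ⟨trivial, ht⟩
  exact h2.clm_comp contDiffOn_const

theorem norm_partialDeriv_sub_le (Γ' : EquivariantFamily A X₀ a b) :
    ‖Γ'.partialDeriv t - Γ.partialDeriv t‖ ≤
      ‖fderiv ℝ Γ'.toFun (X₀, t) - fderiv ℝ Γ.toFun (X₀, t)‖ := by
  rw [partialDeriv, partialDeriv, ← ContinuousLinearMap.sub_comp]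
  exact (ContinuousLinearMap.opNorm_comp_le _ _).trans
    (mul_le_of_le_one_right (norm_nonneg _) (ContinuousLinearMap.norm_inl_le_one ℝ W ℝ))

variable [FiniteDimensional ℝ W] in
theorem partialDeriv_mem_equivariantMaps (hX₀ : ∀ s, A s X₀ = X₀) (ht : t ∈ Set.Ioo a b) :
    Γ.partialDeriv t ∈ equivariantMaps A := by
  refine mem_equivariantMaps.2 fun s x => ?_
  let As : W →L[ℝ] W := LinearMap.toContinuousLinearMap (A s)
  have hD := Γ.hasFDerivAt_partialDeriv ht
  have h1 : HasFDerivAt (fun X : W => Γ.toFun (A s X, t)) ((Γ.partialDeriv t).comp As) X₀ :=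
    HasFDerivAt.comp (g := fun X : W => Γ.toFun (X, t)) X₀
      (show HasFDerivAt _ _ (As X₀) from (hX₀ s).symm ▸ hD) As.hasFDerivAt
  have h2 : HasFDerivAt (fun X : W => Γ.toFun (A s X, t)) (As.comp (Γ.partialDeriv t)) X₀ := by
    rw [show (fun X : W => Γ.toFun (A s X, t)) = fun X => As (Γ.toFun (X, t)) from
      funext fun X => Γ.equivariant s X t ht]
    exact As.hasFDerivAt.comp X₀ hD
  exact congrArg (fun L : W →L[ℝ] W => L x) (h1.unique h2)

variable [FiniteDimensional ℝ W] in
theorem mem_generalPosition_iff {ι : Type*} [Fintype ι] [DecidableEq ι] {U : ι → Submodule ℝ W}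
    {hU : ∀ i, IsSubrep A (U i)} (h : IsMultiplicityFree A U hU) (hX₀ : ∀ s, A s X₀ = X₀) :
    Γ ∈ generalPosition A X₀ a b ↔
      ∀ t ∈ Set.Ioo a b, ∀ k, Γ.partialDeriv t ∉ h.degenerate k := by
  refine forall₂_congr fun t ht => ?_
  rw [Γ.linearization_eq ht]
  exact h.generalizedKernel_iff_forall_notMem_degenerate
    (Γ.partialDeriv_mem_equivariantMaps hX₀ ht)

/-- The family `Γ(X; t) + ρ(t) e (X - X₀)`, for an equivariant linear map `e` and a smooth function
`ρ` that vanishes outside the parameter interval. -/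
noncomputable def perturb (hX₀ : ∀ s, A s X₀ = X₀) (e : equivariantMaps A) (ρ : ℝ → ℝ)
    (hρ : ContDiff ℝ ∞ ρ) (hρ0 : ∀ t ∉ Set.Ioo a b, ρ t = 0) : EquivariantFamily A X₀ a b where
  toFun p := Γ.toFun p + ρ p.2 • (e : W →L[ℝ] W) (p.1 - X₀)
  smooth := by
    refine Γ.smooth.add (ContDiff.contDiffOn ?_)
    exact (hρ.comp contDiff_snd).smul
      ((e : W →L[ℝ] W).contDiff.comp (contDiff_fst.sub contDiff_const))
  equivariant s X t ht := by
    have he : (e : W →L[ℝ] W) (A s X - X₀) = A s ((e : W →L[ℝ] W) (X - X₀)) := by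
      conv_lhs => rw [← hX₀ s, ← map_sub]
      exact mem_equivariantMaps.1 e.2 s _
    rw [map_add, map_smul, ← he, Γ.equivariant s X t ht]
  equilibrium t ht := by simp [Γ.equilibrium t ht]
  zero_outside X t ht := by simp [Γ.zero_outside X t ht, hρ0 t ht]

section Perturb

variable (hX₀ : ∀ s, A s X₀ = X₀) (e : equivariantMaps A) {ρ : ℝ → ℝ}
  (hρ : ContDiff ℝ ∞ ρ) (hρ0 : ∀ t ∉ Set.Ioo a b, ρ t = 0)

theorem partialDeriv_perturb (ht : t ∈ Set.Ioo a b) :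
    (Γ.perturb hX₀ e ρ hρ hρ0).partialDeriv t = Γ.partialDeriv t + ρ t • (e : W →L[ℝ] W) := by
  refine ((Γ.perturb hX₀ e ρ hρ hρ0).hasFDerivAt_partialDeriv ht).unique
    ((Γ.hasFDerivAt_partialDeriv ht).add (HasFDerivAt.const_smul ?_ (ρ t)))
  exact ((e : W →L[ℝ] W).hasFDerivAt.comp X₀ ((hasFDerivAt_id X₀).sub_const X₀))

theorem norm_fderiv_perturb_sub_le (X : W) (ht : t ∈ Set.Ioo a b) :
    ‖fderiv ℝ (Γ.perturb hX₀ e ρ hρ hρ0).toFun (X, t) - fderiv ℝ Γ.toFun (X, t)‖ ≤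
      |ρ t| * ‖e‖ + ‖fderiv ℝ ρ t‖ * (‖e‖ * ‖X - X₀‖) := by
  have h1 : HasFDerivAt (fun p : W × ℝ => ρ p.2)
      ((fderiv ℝ ρ t).comp (ContinuousLinearMap.snd ℝ W ℝ)) (X, t) :=
    HasFDerivAt.comp (X, t) (hρ.differentiable (by simp) t).hasFDerivAt hasFDerivAt_snd
  have h2 : HasFDerivAt (fun p : W × ℝ => (e : W →L[ℝ] W) (p.1 - X₀))
      ((e : W →L[ℝ] W).comp (ContinuousLinearMap.fst ℝ W ℝ)) (X, t) :=
    (e : W →L[ℝ] W).hasFDerivAt.comp (X, t) (hasFDerivAt_fst.sub_const X₀)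
  have h3 := ((Γ.differentiableAt X ht).hasFDerivAt.add (h1.smul h2)).fderiv
  have h4 : fderiv ℝ (Γ.perturb hX₀ e ρ hρ hρ0).toFun (X, t) = _ := h3
  rw [h4, add_sub_cancel_left]
  refine (norm_add_le _ _).trans (add_le_add ?_ ?_)
  · rw [norm_smul, Real.norm_eq_abs]
    gcongr
    exact (ContinuousLinearMap.opNorm_comp_le _ _).trans
      (mul_le_of_le_one_right (norm_nonneg _) (ContinuousLinearMap.norm_fst_le ℝ W ℝ))
  · rw [ContinuousLinearMap.norm_smulRight_apply]
    gcongr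
    · exact (ContinuousLinearMap.opNorm_comp_le _ _).trans
        (mul_le_of_le_one_right (norm_nonneg _) (ContinuousLinearMap.norm_snd_le ℝ W ℝ))
    · exact (e : W →L[ℝ] W).le_opNorm _

end Perturb

/-! ### General position is open and dense -/

variable [FiniteDimensional ℝ W] {ι : Type*} [Fintype ι] [DecidableEq ι] {U : ι → Submodule ℝ W}
  {hU : ∀ i, IsSubrep A (U i)}

omit Γ in
/-- General position says that the curve of linearizations avoids a closed set, so the distance to
this set is an admissible gauge. -/
theorem isOpen_generalPosition (h : IsMultiplicityFree A U hU) (hX₀ : ∀ s, A s X₀ = X₀) :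
    IsOpen (generalPosition A X₀ a b) := by
  intro Γ hΓ
  rw [Γ.mem_generalPosition_iff h hX₀] at hΓ
  rcases isEmpty_or_nonempty h.DegenerateIndex with hκ | ⟨⟨k₀⟩⟩
  · exact ⟨∅, fun _ => 1, isCompact_empty, continuousOn_const, fun _ _ => one_pos,
      fun Γ' _ => (Γ'.mem_generalPosition_iff h hX₀).2 fun t _ k => hκ.elim k⟩
  set B : Set (W →L[ℝ] W) := ⋃ k, (h.degenerate k : Set (W →L[ℝ] W))
  have hBc : IsClosed B := isClosed_iUnion_of_finite fun k =>
    (h.degenerate k).closed_of_finiteDimensional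
  have hBne : B.Nonempty := ⟨0, Set.mem_iUnion.2 ⟨k₀, zero_mem _⟩⟩
  refine ⟨{X₀}, fun t => Metric.infDist (Γ.partialDeriv t) B, isCompact_singleton,
    (Metric.continuous_infDist_pt B).comp_continuousOn Γ.contDiffOn_partialDeriv.continuousOn,
    fun t ht => (hBc.notMem_iff_infDist_pos hBne).1 fun hmem => ?_, fun Γ' hΓ' => ?_⟩
  · obtain ⟨k, hk⟩ := Set.mem_iUnion.1 hmem
    exact hΓ t ht k hk
  · refine (Γ'.mem_generalPosition_iff h hX₀).2 fun t ht k hk => ?_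
    have h1 := (Γ.norm_partialDeriv_sub_le Γ').trans_lt (hΓ' X₀ rfl t ht).2
    rw [← dist_eq_norm, dist_comm] at h1
    exact (Metric.infDist_le_dist_of_mem (Set.mem_iUnion.2 ⟨k, hk⟩)).not_gt h1

/-- For a function `ρ` that is positive on the parameter interval there is an equivariant map `e` of
norm at most one for which `Γ(X; t) + ρ(t) e (X - X₀)` is in general position. As the degenerate
maps form linear subspaces, it suffices that the curve `D_X Γ(X₀; t) / ρ(t) + e` avoids them. -/
theorem exists_perturb_mem_generalPosition (h : IsMultiplicityFree A U hU)
    (hX₀ : ∀ s, A s X₀ = X₀) {ρ : ℝ → ℝ} (hρ : ContDiff ℝ ∞ ρ)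
    (hρ0 : ∀ t ∉ Set.Ioo a b, ρ t = 0) (hρpos : ∀ t ∈ Set.Ioo a b, 0 < ρ t) :
    ∃ e : equivariantMaps A, ‖e‖ ≤ 1 ∧ Γ.perturb hX₀ e ρ hρ hρ0 ∈ generalPosition A X₀ a b := by
  have hM : ContDiffOn ℝ 1 (fun t => (ρ t)⁻¹ • Γ.partialDeriv t) (Set.Ioo a b) :=
    ((hρ.of_le (mod_cast le_top)).contDiffOn.inv fun t ht => (hρpos t ht).ne').smul
      (Γ.contDiffOn_partialDeriv.of_le (mod_cast le_top))
  obtain ⟨e, he1, he⟩ := exists_norm_le_one_forall_add_notMem (equivariantMaps A) h.degenerate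
    h.finrank_degenerate_add_two_le hM fun t ht =>
      (equivariantMaps A).smul_mem _ (Γ.partialDeriv_mem_equivariantMaps hX₀ ht)
  refine ⟨e, he1, (mem_generalPosition_iff _ h hX₀).2 fun t ht k hk => he t ht k ?_⟩
  rw [Γ.partialDeriv_perturb hX₀ e hρ hρ0 ht] at hk
  have hmem := (h.degenerate k).smul_mem (ρ t)⁻¹ hk
  rwa [smul_add, smul_smul, inv_mul_cancel₀ (hρpos t ht).ne', one_smul] at hmem

omit Γ in
theorem dense_generalPosition (h : IsMultiplicityFree A U hU) (hX₀ : ∀ s, A s X₀ = X₀) :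
    Dense (generalPosition A X₀ a b) := by
  rw [dense_iff_inter_open]
  rintro 𝒰 h𝒰 ⟨Γ, hΓ⟩
  obtain ⟨K, ε, hK, hε, hpos, hsub⟩ := h𝒰 Γ hΓ
  obtain ⟨R, hR0, hR⟩ : ∃ R : ℝ, 0 ≤ R ∧ ∀ X ∈ K, ‖X - X₀‖ ≤ R := by
    obtain ⟨R, hR⟩ := (hK.image
      (continuous_id.sub continuous_const : Continuous (· - X₀))).isBounded.exists_norm_le
    exact ⟨max R 0, le_max_right _ _, fun X hX =>
      (hR _ (Set.mem_image_of_mem _ hX)).trans (le_max_left _ _)⟩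
  -- `ρ` and `ρ'` enter the derivative of `ρ(t) e (X - X₀)` with factors `1` and `R`
  obtain ⟨ρ, hρ, hρpos, hρ0, hρε⟩ := exists_contDiff_pos_le_gauge (isOpen_Ioo (a := a) (b := b))
    (hε.div_const (R + 2)) fun t ht => div_pos (hpos t ht) (by positivity)
  obtain ⟨e, he1, he⟩ := Γ.exists_perturb_mem_generalPosition h hX₀ hρ hρ0 hρpos
  refine ⟨Γ.perturb hX₀ e ρ hρ hρ0, hsub fun X hX t ht => ?_, he⟩
  obtain ⟨hρ1, hρ2⟩ := hρε t ht
  have hδ : ε t / (R + 2) * (1 + R) < ε t := by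
    rw [div_mul_eq_mul_div, div_lt_iff₀ (by positivity)]
    exact mul_lt_mul_of_pos_left (by linarith) (hpos t ht)
  have hδ0 : 0 < ε t / (R + 2) := div_pos (hpos t ht) (by positivity)
  have heX : ‖e‖ * ‖X - X₀‖ ≤ R :=
    (mul_le_of_le_one_left (norm_nonneg _) he1).trans (hR X hX)
  constructor
  · refine lt_of_le_of_lt ?_ hδ
    rw [show (Γ.perturb hX₀ e ρ hρ hρ0).toFun (X, t) - Γ.toFun (X, t) =
      ρ t • (e : W →L[ℝ] W) (X - X₀) from add_sub_cancel_left _ _, norm_smul, Real.norm_eq_abs]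
    have := ((e : W →L[ℝ] W).le_opNorm (X - X₀)).trans heX
    exact mul_le_mul hρ1 (by linarith) (norm_nonneg _) hδ0.le
  · refine ((Γ.norm_fderiv_perturb_sub_le hX₀ e hρ hρ0 X ht).trans ?_).trans_lt hδ
    rw [mul_add]
    exact add_le_add (mul_le_mul hρ1 he1 (norm_nonneg _) hδ0.le)
      (mul_le_mul hρ2 heX (by positivity) hδ0.le)

end EquivariantFamily

end SemigroupRep

theorem mainTheorem3 {S : Type*} [Semigroup S] {W : Type*} [NormedAddCommGroup W]
    [NormedSpace ℝ W] [FiniteDimensional ℝ W] (A : S →ₙ* Module.End ℝ W)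
    (hA : SemigroupRep.SplitsIntoNonIsomorphicIndecomposables A)
    (X₀ : W) (hX₀ : ∀ s : S, A s X₀ = X₀) (a b : ℝ) (hab : a < b) :
    IsOpen (SemigroupRep.EquivariantFamily.generalPosition A X₀ a b) ∧
      Dense (SemigroupRep.EquivariantFamily.generalPosition A X₀ a b) := by
  obtain ⟨m, U, hU, h1, h2, h3⟩ := hA
  have h : SemigroupRep.IsMultiplicityFree A U hU := ⟨h1, h2, h3⟩
  exact ⟨SemigroupRep.EquivariantFamily.isOpen_generalPosition h hX₀,
    SemigroupRep.EquivariantFamily.dense_generalPosition h hX₀⟩
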